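/- Let $\mathbb K$ be an algebraically closed field of characteristic zero, $d\ge 0$, $\underline X=(X_1,\dots,X_d)$, and order $\mathbb Q^d$ componentwise ($\alpha\le\beta$ iff $\alpha_j\le\beta_j$ for all $j$; $\alpha<\beta$ iff $\alpha\le\beta$ and $\alpha\ne\beta$). A monic polynomial $f(Y)=Y^n+a_1Y^{n-1}+\dots+a_n\in\mathbb K[[\underline X]][Y]$ is a *Weierstrass polynomial* if $a_i(0)=0$ for $i=1,\dots,n$, and it is *quasi-ordinary* if its $Y$-discriminant equals $\underline X^{\alpha}u(\underline X)$ with $\alpha\in\mathbb N^d$ and $u\in\mathbb K[[\underline X]]$, $u(0)\neq0$. A quasi-ordinary Weierstrass polynomial $f$ has all its roots in $\mathbb K[[X_1^{1/k},\dots,X_d^{1/k}]]$ for some integer $k\ge1$ (Abhyankar–Jung), and the difference of two distinct roots $Y_i,Y_j$ has the form $\underline X^{\lambda}u$ with $\lambda\in\frac1k\mathbb N^d$, $u\in\mathbb K[[X_1^{1/k},\dots,X_d^{1/k}]]$, $u(0)\ne0$; the exponent $O(Y_i,Y_j):=\lambda$ is called the contact of $Y_i$ and $Y_j$. If $f$ is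 moreover irreducible in $\mathbb K[[\underline X]][Y]$, the set $\{O(Y_j,Y_i): j\neq i\}$ does not depend on the root $Y_i$; if it equals $\{h_1,\dots,h_g\}$ with $h_1<h_2<\dots<h_g$, then $h_1,\dots,h_g$ is called the *sequence of characteristic exponents* of $f$. **Lemma.** A finite sequence $h_1,\dots,h_g$ ($g\ge0$) of elements of $\mathbb Q_{\ge0}^d$ is the sequence of characteristic exponents of some irreducible quasi-ordinary Weierstrass polynomial $f(Y)\in\mathbb K[[X_1,\dots,X_d]][Y]$ if and only if - (C1) $h_1<h_2<\dots<h_g$, and - (C2) $h_i\notin\mathbb Z^d+\mathbb Zh_1+\dots+\mathbb Zh_{i-1}$ for $i=1,\dots,g$ (for $i=1$: $h_1\notin\mathbb Z^d$). -/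

import Mathlib

namespace QuasiOrdinary

noncomputable section

/-- A unitary polynomial `Y ^ n + a₁ Y ^ (n - 1) + ⋯ + aₙ` over `K[[X₁, …, X_d]]` is a Weierstrass
polynomial if `a₁(0) = ⋯ = aₙ(0) = 0`. -/
def IsWeierstrass {K : Type*} [Field K] {d : ℕ}
    (f : Polynomial (MvPowerSeries (Fin d) K)) : Prop :=
  f.Monic ∧ ∀ i < f.natDegree, MvPowerSeries.constantCoeff (f.coeff i) = 0

/-- A unitary polynomial over `K[[X₁, …, X_d]]` is quasi-ordinary if its discriminant is a
monomial `X₁ ^ α₁ ⋯ X_d ^ α_d` times a power series `u` with `u(0) ≠ 0`. -/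
def IsQuasiOrdinary {K : Type*} [Field K] {d : ℕ}
    (f : Polynomial (MvPowerSeries (Fin d) K)) : Prop :=
  f.Monic ∧ ∃ (α : Fin d →₀ ℕ) (u : MvPowerSeries (Fin d) K),
    MvPowerSeries.constantCoeff u ≠ 0 ∧ f.discr = MvPowerSeries.monomial α 1 * u

/-- The ring `K[[X₁ ^ (1 / k), …, X_d ^ (1 / k)]]` is the ring of formal power series in the
variables `Tᵢ = Xᵢ ^ (1 / k)`; as an extension of `K[[X₁, …, X_d]]` it is given by the embedding
`Xᵢ ↦ Tᵢ ^ k`, which is `MvPowerSeries.expand k`. This is the polynomial `f` with its coefficients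
taken in the larger ring. -/
def overRoots {K : Type*} [Field K] {d : ℕ} (k : ℕ) (hk : k ≠ 0)
    (f : Polynomial (MvPowerSeries (Fin d) K)) : Polynomial (MvPowerSeries (Fin d) K) :=
  f.map (MvPowerSeries.expand (σ := Fin d) (R := K) k hk : MvPowerSeries (Fin d) K →+* _)

/-- `HasContact k y z l`: the elements `y`, `z` of `K[[X₁ ^ (1 / k), …, X_d ^ (1 / k)]]` have
contact `l ∈ (1 / k) ℕ ^ d`, that is, `y - z = X ^ l * u` with `u(0) ≠ 0`. In the variables
`Tᵢ = Xᵢ ^ (1 / k)` the monomial `X ^ l` is `T ^ β` with `β = k l`. -/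
def HasContact {K : Type*} [Field K] {d : ℕ} (k : ℕ) (y z : MvPowerSeries (Fin d) K)
    (l : Fin d → ℚ) : Prop :=
  ∃ (β : Fin d →₀ ℕ) (u : MvPowerSeries (Fin d) K),
    MvPowerSeries.constantCoeff u ≠ 0 ∧ y - z = MvPowerSeries.monomial β 1 * u ∧
      ∀ j, l j = (β j : ℚ) / (k : ℚ)

/-- `h₁, …, h_g` is the sequence of characteristic exponents of the (irreducible quasi-ordinary
Weierstrass) polynomial `f`: all roots of `f` lie in `K[[X₁ ^ (1 / k), …, X_d ^ (1 / k)]]` for some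
`k`, the sequence is strictly increasing for the product order of `ℚ ^ d`, and for every root `y`
the set of contacts of `y` with the other roots is `{h₁, …, h_g}`. -/
def IsCharacteristicSequence {K : Type*} [Field K] {d g : ℕ}
    (f : Polynomial (MvPowerSeries (Fin d) K)) (h : Fin g → Fin d → ℚ) : Prop :=
  StrictMono h ∧ ∃ (k : ℕ) (hk : k ≠ 0), (overRoots k hk f).Splits ∧
    ∀ y, (overRoots k hk f).IsRoot y →
      (∀ z, (overRoots k hk f).IsRoot z → z ≠ y → ∃ i, HasContact k z y (h i)) ∧
      (∀ i, ∃ z, (overRoots k hk f).IsRoot z ∧ z ≠ y ∧ HasContact k z y (h i))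

/-- The subgroup `ℤ ^ d` of `ℚ ^ d`. -/
def integerLattice (d : ℕ) : AddSubgroup (Fin d → ℚ) where
  carrier := {v | ∀ j, ∃ m : ℤ, v j = m}
  zero_mem' := fun _ => ⟨0, by simp⟩
  add_mem' := by
    intro a b ha hb j
    obtain ⟨m, hm⟩ := ha j
    obtain ⟨n, hn⟩ := hb j
    exact ⟨m + n, by simp [hm, hn]⟩
  neg_mem' := by
    intro a ha j
    obtain ⟨m, hm⟩ := ha j
    exact ⟨-m, by simp [hm]⟩

/-- The subgroup `ℤ ^ d + ℤ h₁ + ⋯ + ℤ h_{i-1}` of `ℚ ^ d`. -/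
def latticeBefore {d g : ℕ} (h : Fin g → Fin d → ℚ) (i : Fin g) : AddSubgroup (Fin d → ℚ) :=
  integerLattice d ⊔ AddSubgroup.closure (h '' Set.Iio i)

end

end QuasiOrdinary

/-! ### The action of roots of unity on `K[[X^{1/k}]]` and its fixed ring. -/

namespace QuasiOrdinary

noncomputable section

open Polynomial

variable {K : Type*} [Field K] {d : ℕ}

/-! Tuples `ε` of `k`-th roots of unity act on `K[[X^{1/k}]]` with fixed ring `K[[X]]`, so the roots
of an irreducible `f` form one orbit (`overRoots_eq_orbitPoly`). A twist scales each monomial by the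
value of a character, so a contact of `twist ε y` with `y` is the least exponent in the support of
`y` that `ε` moves.

Necessity (`notMem_latticeBefore`): let `ε` realise the contact `h i`. Each earlier `h j` lies in
the support of `y`, hence is fixed by `ε`. The exponents fixed by `ε` form a group containing `ℤ^d`,
so they contain the lattice before `h i` but not `h i`.

Sufficiency (`exists_isCharacteristicSequence`): take `y = ∑ X^{h i}` and the polynomial of its
orbit. Every difference of conjugates is a monomial `X^{h i}` times a unit, and by (C2) some
character separates `h i` from the lattice before it (`exists_weight_ne_one`), so each `h i` occurs.
-/

instance : IsDomain (MvPowerSeries (Fin d) K) := NoZeroDivisors.to_isDomain _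

/-- The Laurent monomial with exponent `w`, evaluated at `ε`. -/
def weight (ε : Fin d → Kˣ) (w : Fin d → ℤ) : Kˣ := ∏ s, ε s ^ w s

theorem weight_add (ε : Fin d → Kˣ) (v w : Fin d → ℤ) :
    weight ε (v + w) = weight ε v * weight ε w := by
  simp [weight, zpow_add, Finset.prod_mul_distrib]

theorem weight_neg (ε : Fin d → Kˣ) (w : Fin d → ℤ) : weight ε (-w) = (weight ε w)⁻¹ := by
  simp [weight]

theorem weight_mul (ε δ : Fin d → Kˣ) (w : Fin d → ℤ) :
    weight (ε * δ) w = weight ε w * weight δ w := by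
  simp [weight, mul_zpow, Finset.prod_mul_distrib]

/-- The group of `d`-tuples of `k`-th roots of unity, the Galois group of
`K[[X₁ ^ (1 / k), …, X_d ^ (1 / k)]]` over `K[[X₁, …, X_d]]`. -/
abbrev Deck (K : Type*) [Field K] (d k : ℕ) := Fin d → rootsOfUnity k K

variable {k : ℕ}

/-- The units underlying a tuple of roots of unity. -/
def Deck.units (ε : Deck K d k) : Fin d → Kˣ := fun s => ε s

theorem Deck.units_mul (ε δ : Deck K d k) : (ε * δ).units = ε.units * δ.units := rfl

/-- The exponent of a monomial as an integer vector. -/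
def intExp (n : Fin d →₀ ℕ) : Fin d → ℤ := fun s => n s

theorem weight_smul (ε : Deck K d k) (w : Fin d → ℤ) : weight ε.units ((k : ℤ) • w) = 1 := by
  refine Finset.prod_eq_one fun s _ => ?_
  have : (ε.units s) ^ k = 1 := (mem_rootsOfUnity k _).1 (ε s).2
  simp [zpow_mul, this]

/-- The automorphism of `K[[X₁ ^ (1 / k), …, X_d ^ (1 / k)]]` multiplying the variables by roots of
unity. -/
def twist (ε : Deck K d k) : MvPowerSeries (Fin d) K →+* MvPowerSeries (Fin d) K :=
  MvPowerSeries.rescale fun s => (ε.units s : K)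

theorem coeff_twist (ε : Deck K d k) (n : Fin d →₀ ℕ) (f : MvPowerSeries (Fin d) K) :
    MvPowerSeries.coeff n (twist ε f) = weight ε.units (intExp n) * MvPowerSeries.coeff n f := by
  rw [twist, MvPowerSeries.coeff_rescale, Finsupp.prod_fintype _ _ (by simp)]
  simp [weight, intExp]

theorem twist_mul (ε δ : Deck K d k) (f : MvPowerSeries (Fin d) K) :
    twist (ε * δ) f = twist ε (twist δ f) := by
  ext n
  simp [coeff_twist, Deck.units_mul, weight_mul, mul_assoc]

theorem twist_one (f : MvPowerSeries (Fin d) K) : twist (1 : Deck K d k) f = f := by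
  ext n
  have : (1 : Deck K d k).units = 1 := rfl
  simp [coeff_twist, this, weight]

theorem constantCoeff_twist (ε : Deck K d k) (f : MvPowerSeries (Fin d) K) :
    MvPowerSeries.constantCoeff (twist ε f) = MvPowerSeries.constantCoeff f := by
  rw [← MvPowerSeries.coeff_zero_eq_constantCoeff_apply, coeff_twist]
  simp [weight, intExp]

theorem exists_eq_smul_of_dvd {m : Fin d →₀ ℕ} (h : ∀ i, k ∣ m i) : ∃ n, m = k • n := by
  choose c hc using h
  exact ⟨Finsupp.equivFunOnFinite.symm c, by ext i; simp [hc i]⟩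

theorem intExp_smul (n : Fin d →₀ ℕ) : intExp (k • n) = (k : ℤ) • intExp n := by
  ext i
  simp [intExp]

variable (hk : k ≠ 0)
include hk

theorem expand_injective :
    Function.Injective (MvPowerSeries.expand (σ := Fin d) (R := K) k hk) := fun f g h => by
  ext n
  rw [← MvPowerSeries.coeff_expand_smul k hk, h, MvPowerSeries.coeff_expand_smul]

theorem twist_expand (ε : Deck K d k) (f : MvPowerSeries (Fin d) K) :
    twist ε (MvPowerSeries.expand k hk f) = MvPowerSeries.expand k hk f := by
  ext m
  rw [coeff_twist]
  by_cases h : ∀ i, k ∣ m i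
  · obtain ⟨n, rfl⟩ := exists_eq_smul_of_dvd h
    rw [intExp_smul, weight_smul, Units.val_one, one_mul]
  · push Not at h
    obtain ⟨i, hi⟩ := h
    simp [MvPowerSeries.coeff_expand_of_not_dvd k hk f hi]

variable [IsAlgClosed K] [CharZero K]

/-- If `k ∤ m i`, twisting the `i`-th variable alone by a primitive root `ζ` scales the coefficient
at `m` by `ζ ^ m i ≠ 1`, so an invariant series has coefficient zero there. -/
theorem exists_expand_eq_of_twist_eq {f : MvPowerSeries (Fin d) K}
    (hf : ∀ ε : Deck K d k, twist ε f = f) : ∃ g, MvPowerSeries.expand k hk g = f := by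
  obtain ⟨g, hg⟩ : ∃ g : MvPowerSeries (Fin d) K, ∀ n,
      MvPowerSeries.coeff n g = MvPowerSeries.coeff (k • n) f :=
    ⟨fun n => MvPowerSeries.coeff (k • n) f, fun _ => rfl⟩
  refine ⟨g, ?_⟩
  ext m
  by_cases h : ∀ i, k ∣ m i
  · obtain ⟨n, rfl⟩ := exists_eq_smul_of_dvd h
    rw [MvPowerSeries.coeff_expand_smul, hg]
  · push Not at h
    obtain ⟨i, hi⟩ := h
    rw [MvPowerSeries.coeff_expand_of_not_dvd k hk _ hi]
    have : NeZero k := ⟨hk⟩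
    have : NeZero (k : K) := ⟨by exact_mod_cast hk⟩
    obtain ⟨ζ, hζ⟩ := HasEnoughRootsOfUnity.exists_primitiveRoot K k
    let ε : Deck K d k := fun s => if s = i then hζ.toRootsOfUnity else 1
    have hw : (weight ε.units (intExp m) : K) = ζ ^ m i := by
      rw [weight, Finset.prod_eq_single i]
      · simp [ε, Deck.units, intExp]
      · intro s _ hs
        simp [ε, Deck.units, hs]
      · simp
    have h1 := congrArg (MvPowerSeries.coeff m) (hf ε)
    rw [coeff_twist, hw] at h1
    by_contra h0
    exact hi (hζ.dvd_of_pow_eq_one _ (mul_right_cancel₀ (Ne.symm h0) (by rw [h1, one_mul])))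

end

/-! ### Orbit polynomials, their descent to `K[[X]]` and irreducibility. -/

noncomputable section

open Polynomial

variable {K : Type*} [Field K] {d k : ℕ}

/-- The orbit of a power series under the twists. -/
def orbit (k : ℕ) [NeZero k] (y : MvPowerSeries (Fin d) K) : Finset (MvPowerSeries (Fin d) K) :=
  (Set.finite_range fun ε : Deck K d k => twist ε y).toFinset

/-- The polynomial whose roots are the conjugates of `y`. -/
def orbitPoly (k : ℕ) [NeZero k] (y : MvPowerSeries (Fin d) K) :
    Polynomial (MvPowerSeries (Fin d) K) :=
  ∏ z ∈ orbit k y, (X - C z)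

theorem natDegree_overRoots (hk : k ≠ 0) {f : Polynomial (MvPowerSeries (Fin d) K)}
    (hf : f.Monic) : (overRoots k hk f).natDegree = f.natDegree := hf.natDegree_map _

theorem map_twist_overRoots (hk : k ≠ 0) (ε : Deck K d k)
    (f : Polynomial (MvPowerSeries (Fin d) K)) :
    (overRoots k hk f).map (twist ε) = overRoots k hk f := by
  ext1 n
  simpa [overRoots] using twist_expand hk ε _

theorem isRoot_twist (hk : k ≠ 0) {y : MvPowerSeries (Fin d) K}
    {f : Polynomial (MvPowerSeries (Fin d) K)} (hy : (overRoots k hk f).IsRoot y) (ε : Deck K d k) :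
    (overRoots k hk f).IsRoot (twist ε y) := by
  rw [← map_twist_overRoots hk ε]
  exact hy.map

variable [NeZero k] (y : MvPowerSeries (Fin d) K)

theorem mem_orbit {y z : MvPowerSeries (Fin d) K} :
    z ∈ orbit k y ↔ ∃ ε : Deck K d k, twist ε y = z := by
  simp [orbit]

theorem self_mem_orbit : y ∈ orbit k y := mem_orbit.2 ⟨1, twist_one y⟩

variable {y} in
theorem twist_mem_orbit {z : MvPowerSeries (Fin d) K} (ε : Deck K d k) (hz : z ∈ orbit k y) :
    twist ε z ∈ orbit k y := by
  obtain ⟨δ, rfl⟩ := mem_orbit.1 hz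
  exact mem_orbit.2 ⟨ε * δ, twist_mul _ _ _⟩

theorem orbitPoly_monic : (orbitPoly k y).Monic := monic_prod_X_sub_C _ _

theorem orbitPoly_splits : (orbitPoly k y).Splits :=
  Splits.prod fun _ _ => Splits.X_sub_C _

theorem roots_orbitPoly : (orbitPoly k y).roots = (orbit k y).val := roots_prod_X_sub_C _

variable {y} in
theorem isRoot_orbitPoly {z : MvPowerSeries (Fin d) K} :
    (orbitPoly k y).IsRoot z ↔ z ∈ orbit k y := by
  rw [← mem_roots (orbitPoly_monic y).ne_zero, roots_orbitPoly, Finset.mem_val]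

theorem natDegree_orbitPoly : (orbitPoly k y).natDegree = (orbit k y).card :=
  natDegree_finsetProd_X_sub_C_eq_card _ _

theorem natDegree_orbitPoly_pos : 0 < (orbitPoly k y).natDegree := by
  rw [natDegree_orbitPoly]
  exact Finset.card_pos.2 ⟨y, self_mem_orbit y⟩

theorem map_twist_orbitPoly (ε : Deck K d k) :
    (orbitPoly k y).map (twist ε) = orbitPoly k y := by
  simp only [orbitPoly, Polynomial.map_prod, Polynomial.map_sub, map_X, map_C]
  refine Finset.prod_nbij' (twist ε) (twist ε⁻¹) (fun z hz => twist_mem_orbit _ hz)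
    (fun z hz => twist_mem_orbit _ hz) (fun z _ => ?_) (fun z _ => ?_) (fun _ _ => rfl)
  · rw [← twist_mul, inv_mul_cancel, twist_one]
  · rw [← twist_mul, mul_inv_cancel, twist_one]

variable (hk : k ≠ 0)

variable {y} in
theorem orbitPoly_dvd {f : Polynomial (MvPowerSeries (Fin d) K)} (hf : f.Monic)
    (hy : (overRoots k hk f).IsRoot y) : orbitPoly k y ∣ overRoots k hk f := by
  have h0 : overRoots k hk f ≠ 0 := (hf.map _).ne_zero
  refine (Multiset.prod_X_sub_C_dvd_iff_le_roots h0 (orbit k y).val).2 ?_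
  rw [Multiset.le_iff_subset (orbit k y).nodup]
  intro z hz
  obtain ⟨ε, rfl⟩ := mem_orbit.1 hz
  exact (mem_roots h0).2 (isRoot_twist hk hy ε)

variable {y} in
-- A monic factor vanishing at `y` vanishes on the whole orbit, so it already has full degree and
-- its cofactor is `1`.
theorem irreducible_of_overRoots_eq_orbitPoly {f : Polynomial (MvPowerSeries (Fin d) K)}
    (hf : f.Monic) (hy : overRoots k hk f = orbitPoly k y) : Irreducible f := by
  have key : ∀ a b : Polynomial (MvPowerSeries (Fin d) K), a.Monic → b.Monic → a * b = f →
      (overRoots k hk a).IsRoot y → b = 1 := by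
    rintro a b ha hb rfl hr
    have h1 := natDegree_le_of_dvd (orbitPoly_dvd hk ha hr) (ha.map _).ne_zero
    rw [← hy, natDegree_overRoots hk hf, natDegree_overRoots hk ha, ha.natDegree_mul hb] at h1
    exact hb.natDegree_eq_zero.1 (by omega)
  refine (irreducible_of_monic hf ?_).2 fun a b ha hb hab => ?_
  · rintro rfl
    exact absurd (natDegree_orbitPoly_pos (k := k) y) (by simp [← hy, overRoots])
  · have hr : (overRoots k hk a * overRoots k hk b).IsRoot y := by
      rw [overRoots, overRoots, ← Polynomial.map_mul, hab]
      have := isRoot_orbitPoly.2 (self_mem_orbit (k := k) y)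
      rwa [← hy] at this
    rcases root_mul.1 hr with h | h
    · exact Or.inr (key a b ha hb hab h)
    · exact Or.inl (key b a hb ha (by rw [mul_comm, hab]) h)

variable [IsAlgClosed K] [CharZero K]

theorem exists_overRoots_eq_orbitPoly :
    ∃ f : Polynomial (MvPowerSeries (Fin d) K), f.Monic ∧ overRoots k hk f = orbitPoly k y := by
  have hl : orbitPoly k y ∈ lifts
      (MvPowerSeries.expand (σ := Fin d) (R := K) k hk : MvPowerSeries (Fin d) K →+* _) := by
    rw [lifts_iff_coeff_lifts]
    refine fun n => exists_expand_eq_of_twist_eq hk fun ε => ?_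
    rw [← coeff_map, map_twist_orbitPoly]
  obtain ⟨f, hf, -, hm⟩ := lifts_and_natDegree_eq_and_monic hl (orbitPoly_monic y)
  exact ⟨f, hm, hf⟩

variable {y} in
theorem overRoots_eq_orbitPoly {f : Polynomial (MvPowerSeries (Fin d) K)} (hf : f.Monic)
    (hirr : Irreducible f) (hy : (overRoots k hk f).IsRoot y) :
    overRoots k hk f = orbitPoly k y := by
  obtain ⟨g, hg, hgy⟩ := exists_overRoots_eq_orbitPoly y hk
  have hdvd : g ∣ f := by
    -- Divisibility by a monic polynomial can be tested after an injective extension of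
    -- coefficients.
    rw [← map_dvd_map _ (expand_injective hk) hg]
    have := orbitPoly_dvd hk hf hy
    rwa [← hgy] at this
  obtain ⟨q, rfl⟩ := hdvd
  have hq : q.Monic := hg.of_mul_monic_left hf
  rcases (irreducible_of_monic hf hirr.ne_one).1 hirr g q hg hq rfl with h | h
  · exact absurd (natDegree_orbitPoly_pos (k := k) y) (by simp [← hgy, h, overRoots])
  · rw [h, mul_one, hgy]

end

/-! ### Monomials times units, and discriminants. -/

noncomputable section

open Polynomial

variable {K : Type*} [Field K] {d k : ℕ}

/-- The power series of the form `X ^ α * u` with `u(0) ≠ 0`. -/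
def monomialUnits (K : Type*) [Field K] (d : ℕ) : Submonoid (MvPowerSeries (Fin d) K) where
  carrier := {f | ∃ (α : Fin d →₀ ℕ) (u : MvPowerSeries (Fin d) K),
    MvPowerSeries.constantCoeff u ≠ 0 ∧ f = MvPowerSeries.monomial α 1 * u}
  one_mem' := ⟨0, 1, by simp, by simp⟩
  mul_mem' := by
    rintro _ _ ⟨α, u, hu, rfl⟩ ⟨β, v, hv, rfl⟩
    refine ⟨α + β, u * v, by simp [hu, hv], ?_⟩
    rw [← mul_one (1 : K), ← MvPowerSeries.monomial_mul_monomial, mul_one]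
    exact mul_mul_mul_comm _ _ _ _

/-- This turns contacts into statements about supports: `α` is the least element of the support of
`f`. -/
theorem exists_eq_monomial_mul_iff {f : MvPowerSeries (Fin d) K} {α : Fin d →₀ ℕ} :
    (∃ u, MvPowerSeries.constantCoeff u ≠ 0 ∧ f = MvPowerSeries.monomial α 1 * u) ↔
      MvPowerSeries.coeff α f ≠ 0 ∧ ∀ n, MvPowerSeries.coeff n f ≠ 0 → α ≤ n := by
  constructor
  · rintro ⟨u, hu, rfl⟩
    refine ⟨by simpa [MvPowerSeries.coeff_monomial_mul] using hu, fun n hn => ?_⟩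
    by_contra h
    exact hn (by rw [MvPowerSeries.coeff_monomial_mul, if_neg h])
  · rintro ⟨hα, h⟩
    obtain ⟨u, hu⟩ : ∃ u : MvPowerSeries (Fin d) K, ∀ n,
        MvPowerSeries.coeff n u = MvPowerSeries.coeff (α + n) f :=
      ⟨fun n => MvPowerSeries.coeff (α + n) f, fun _ => rfl⟩
    refine ⟨u, ?_, ?_⟩
    · rwa [← MvPowerSeries.coeff_zero_eq_constantCoeff_apply, hu, add_zero]
    · ext n
      rw [MvPowerSeries.coeff_monomial_mul]
      split_ifs with hn
      · rw [hu, add_tsub_cancel_of_le hn, one_mul]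
      · exact not_not.1 fun h0 => hn (h n h0)

theorem mem_monomialUnits_iff {f : MvPowerSeries (Fin d) K} : f ∈ monomialUnits K d ↔
    ∃ α, MvPowerSeries.coeff α f ≠ 0 ∧ ∀ n, MvPowerSeries.coeff n f ≠ 0 → α ≤ n :=
  exists_congr fun _ => exists_eq_monomial_mul_iff

theorem hasContact_iff {y z : MvPowerSeries (Fin d) K} {l : Fin d → ℚ} :
    HasContact k y z l ↔ ∃ β : Fin d →₀ ℕ, (∀ j, l j = (β j : ℚ) / k) ∧
      MvPowerSeries.coeff β (y - z) ≠ 0 ∧ ∀ n, MvPowerSeries.coeff n (y - z) ≠ 0 → β ≤ n := by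
  refine exists_congr fun β => ?_
  rw [← exists_eq_monomial_mul_iff, ← exists_and_left]
  exact exists_congr fun u => ⟨fun h => ⟨h.2.2, h.1, h.2.1⟩, fun h => ⟨h.2.1, h.2.2, h.1⟩⟩

theorem units_mem_monomialUnits {u : MvPowerSeries (Fin d) K}
    (hu : MvPowerSeries.constantCoeff u ≠ 0) : u ∈ monomialUnits K d := ⟨0, u, hu, by simp⟩

theorem mem_monomialUnits_of_expand (hk : k ≠ 0) {f : MvPowerSeries (Fin d) K}
    (hf : MvPowerSeries.expand k hk f ∈ monomialUnits K d) : f ∈ monomialUnits K d := by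
  rw [mem_monomialUnits_iff] at hf ⊢
  obtain ⟨α, hα, h⟩ := hf
  obtain ⟨a, rfl⟩ : ∃ a, α = k • a := by
    refine exists_eq_smul_of_dvd fun i => ?_
    by_contra hi
    exact hα (MvPowerSeries.coeff_expand_of_not_dvd k hk f hi)
  rw [MvPowerSeries.coeff_expand_smul] at hα
  refine ⟨a, hα, fun n hn i => ?_⟩
  have := h (k • n) (by rwa [MvPowerSeries.coeff_expand_smul]) i
  exact le_of_mul_le_mul_left (by simpa using this) hk.bot_lt

theorem discr_map_of_monic {R S : Type*} [CommRing R] [CommRing S] [Nontrivial S] (φ : R →+* S)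
    {f : Polynomial R} (hf : f.Monic) (h0 : 0 < f.natDegree) : (f.map φ).discr = φ f.discr := by
  have h1 := resultant_deriv (natDegree_pos_iff_degree_pos.1 h0)
  have h2 := resultant_deriv (f := f.map φ)
    (natDegree_pos_iff_degree_pos.1 (by rwa [hf.natDegree_map]))
  rw [hf.leadingCoeff, mul_one] at h1
  rw [derivative_map, hf.natDegree_map, resultant_map_map, h1, (hf.map φ).leadingCoeff, mul_one,
    map_mul, map_pow, map_neg, map_one] at h2
  exact ((IsUnit.neg isUnit_one).pow _).mul_left_cancel h2.symm

/-- Up to sign the discriminant is the product of `f'(y)` over the roots, and each `f'(y)` is a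
product of root differences; the monomials times units are closed under products. -/
theorem discr_mem_monomialUnits {f : Polynomial (MvPowerSeries (Fin d) K)} (hf : f.Monic)
    (h0 : 0 < f.natDegree) (hs : f.Splits) (hn : f.roots.Nodup)
    (hd : ∀ y ∈ f.roots, ∀ z ∈ f.roots, z ≠ y → y - z ∈ monomialUnits K d) :
    f.discr ∈ monomialUnits K d := by
  classical
  have h1 := resultant_deriv (natDegree_pos_iff_degree_pos.1 h0)
  rw [hf.leadingCoeff, mul_one,
    resultant_eq_prod_eval _ _ _ (natDegree_derivative_le f) hs, hf.leadingCoeff, one_pow,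
    one_mul] at h1
  have h2 : f.discr = (-1) ^ (f.natDegree * (f.natDegree - 1) / 2) *
      (f.roots.map fun y => f.derivative.eval y).prod := by
    rw [h1, ← mul_assoc, ← mul_pow]
    simp
  rw [h2]
  refine mul_mem (pow_mem (units_mem_monomialUnits (by simp)) _)
    (Submonoid.multiset_prod_mem _ _ fun a ha => ?_)
  obtain ⟨y, hy, rfl⟩ := Multiset.mem_map.1 ha
  rw [hs.eval_root_derivative hf hy]
  refine Submonoid.multiset_prod_mem _ _ fun b hb => ?_
  obtain ⟨z, hz, rfl⟩ := Multiset.mem_map.1 hb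
  rw [hn.mem_erase_iff] at hz
  exact hd y hy z hz.2 hz.1

end

/-! ### Contacts of conjugates and lattices of exponents. -/

noncomputable section

open Polynomial

variable {K : Type*} [Field K] {d k g : ℕ}

theorem coeff_twist_sub (ε δ : Deck K d k) (y : MvPowerSeries (Fin d) K) (n : Fin d →₀ ℕ) :
    MvPowerSeries.coeff n (twist ε y - twist δ y) =
      ((weight ε.units (intExp n) : K) - weight δ.units (intExp n)) *
        MvPowerSeries.coeff n y := by
  rw [map_sub, coeff_twist, coeff_twist, sub_mul]

/-- The subgroup of the exponents in `(1 / k) ℤ ^ d` of the monomials fixed by a tuple of roots of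
unity. -/
def fixedExponents (ε : Deck K d k) : AddSubgroup (Fin d → ℚ) where
  carrier := {v | ∃ w : Fin d → ℤ, (∀ j, (k : ℚ) * v j = w j) ∧ weight ε.units w = 1}
  zero_mem' := ⟨0, by simp, by simp [weight]⟩
  add_mem' := by
    rintro a b ⟨v, hv, hv'⟩ ⟨w, hw, hw'⟩
    exact ⟨v + w, fun j => by simp [mul_add, hv, hw], by rw [weight_add, hv', hw', one_mul]⟩
  neg_mem' := by
    rintro a ⟨v, hv, hv'⟩
    exact ⟨-v, fun j => by simp [hv], by rw [weight_neg, hv', inv_one]⟩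

theorem integerLattice_le_fixedExponents (ε : Deck K d k) :
    integerLattice d ≤ fixedExponents ε := fun v hv => by
  choose m hm using (show ∀ j, ∃ m : ℤ, v j = m from hv)
  exact ⟨(k : ℤ) • m, fun j => by simp [hm], weight_smul ε m⟩

theorem mem_fixedExponents (hk : k ≠ 0) (ε : Deck K d k) {l : Fin d → ℚ} {β : Fin d →₀ ℕ}
    (hl : ∀ j, l j = (β j : ℚ) / k) :
    l ∈ fixedExponents ε ↔ weight ε.units (intExp β) = 1 := by
  have hk' : (k : ℚ) ≠ 0 := by exact_mod_cast hk
  have hβ : ∀ j, (k : ℚ) * l j = intExp β j := fun j => by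
    simp [hl, intExp, mul_div_cancel₀ _ hk']
  refine ⟨fun ⟨w, hw, h1⟩ => ?_, fun h => ⟨intExp β, hβ, h⟩⟩
  have : w = intExp β := funext fun j => by exact_mod_cast (hw j).symm.trans (hβ j)
  rwa [← this]

theorem le_iff_of_eq_div (hk : k ≠ 0) {l m : Fin d → ℚ} {β γ : Fin d →₀ ℕ}
    (hl : ∀ j, l j = (β j : ℚ) / k) (hm : ∀ j, m j = (γ j : ℚ) / k) : l ≤ m ↔ β ≤ γ := by
  have hk' : (0 : ℚ) < k := by exact_mod_cast Nat.pos_of_ne_zero hk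
  refine forall_congr' fun j => ?_
  rw [hl, hm, div_le_div_iff_of_pos_right hk', Nat.cast_le]

section Necessity

variable [IsAlgClosed K] [CharZero K]

theorem notMem_latticeBefore {f : Polynomial (MvPowerSeries (Fin d) K)} (hf : f.Monic)
    (hirr : Irreducible f) {h : Fin g → Fin d → ℚ} (hh : IsCharacteristicSequence f h)
    (i : Fin g) : h i ∉ latticeBefore h i := by
  obtain ⟨hmono, k, hk, hs, hc⟩ := hh
  have : NeZero k := ⟨hk⟩
  obtain ⟨y, hy⟩ := hs.exists_eval_eq_zero fun h0 => by
    have h1 := natDegree_overRoots hk hf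
    rw [natDegree_eq_of_degree_eq_some h0] at h1
    exact hirr.ne_one (hf.natDegree_eq_zero.1 h1.symm)
  have hroot : ∀ j, ∃ (ε : Deck K d k) (β : Fin d →₀ ℕ), (∀ s, h j s = (β s : ℚ) / k) ∧
      MvPowerSeries.coeff β (twist ε y - y) ≠ 0 ∧
      ∀ n, MvPowerSeries.coeff n (twist ε y - y) ≠ 0 → β ≤ n := fun j => by
    obtain ⟨z, hz, -, hzc⟩ := (hc y hy).2 j
    rw [overRoots_eq_orbitPoly hk hf hirr hy, isRoot_orbitPoly, mem_orbit] at hz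
    obtain ⟨ε, rfl⟩ := hz
    exact ⟨ε, hasContact_iff.1 hzc⟩
  have hcoeff : ∀ (ε : Deck K d k) n, MvPowerSeries.coeff n (twist ε y - y) =
      ((weight ε.units (intExp n) : K) - 1) * MvPowerSeries.coeff n y := fun ε n => by
    rw [map_sub, coeff_twist, sub_mul, one_mul]
  obtain ⟨ε, β, hβ, hne, hle⟩ := hroot i
  intro hmem
  have hsub : latticeBefore h i ≤ fixedExponents ε := by
    refine sup_le (integerLattice_le_fixedExponents ε) ((AddSubgroup.closure_le _).2 ?_)
    rintro _ ⟨j, hj, rfl⟩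
    obtain ⟨δ, γ, hγ, hne', -⟩ := hroot j
    refine (mem_fixedExponents hk ε hγ).2 ?_
    -- The exponent `γ` is in the support of `y`, because `δ` moves it; it is not above `β`, the
    -- least exponent moved by `ε`, so `ε` fixes it.
    have hγβ : ¬ β ≤ γ := by
      rw [← le_iff_of_eq_div hk hβ hγ]
      exact (hmono hj).not_ge
    have h0 := not_not.1 (mt (hle γ) hγβ)
    rw [hcoeff] at h0 hne'
    have := (mul_eq_zero.1 h0).resolve_right (right_ne_zero_of_mul hne')
    exact Units.ext (sub_eq_zero.1 this)
  refine hne ?_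
  rw [hcoeff, (mem_fixedExponents hk ε hβ).1 (hsub hmem)]
  simp

end Necessity

theorem exists_common_denominator (h : Fin g → Fin d → ℚ) (h_nonneg : ∀ i j, 0 ≤ h i j) :
    ∃ k : ℕ, k ≠ 0 ∧ ∃ β : Fin g → Fin d →₀ ℕ, ∀ i j, h i j = (β i j : ℚ) / k := by
  have hk : (∏ p : Fin g × Fin d, (h p.1 p.2).den) ≠ 0 :=
    Finset.prod_ne_zero_iff.2 fun p _ => (h p.1 p.2).den_ne_zero
  refine ⟨_, hk, ?_⟩
  have key : ∀ i j, ∃ b : ℕ, h i j = (b : ℚ) / (∏ p : Fin g × Fin d, (h p.1 p.2).den : ℕ) := by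
    intro i j
    obtain ⟨c, hc⟩ := Finset.dvd_prod_of_mem (fun p : Fin g × Fin d => (h p.1 p.2).den)
      (Finset.mem_univ (i, j))
    refine ⟨(h i j).num.toNat * c, ?_⟩
    have hc0 : (c : ℚ) ≠ 0 := by
      rintro h0
      rw [Nat.cast_eq_zero] at h0
      exact hk (by rw [hc, h0, mul_zero])
    have hn : (((h i j).num.toNat : ℕ) : ℚ) = (h i j).num := by
      exact_mod_cast Int.toNat_of_nonneg (Rat.num_nonneg.2 (h_nonneg i j))
    rw [hc]
    push_cast
    rw [hn, mul_div_mul_right _ _ hc0, Rat.num_div_den]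
  choose b hb using key
  exact ⟨fun i => Finsupp.equivFunOnFinite.symm (b i), by simpa using hb⟩

/-- The sum of the monomials with exponents `β i`. -/
def monomialSum (K : Type*) [Field K] (β : Fin g → Fin d →₀ ℕ) : MvPowerSeries (Fin d) K :=
  ∑ i, MvPowerSeries.monomial (β i) 1

theorem coeff_monomialSum {β : Fin g → Fin d →₀ ℕ} (hβ : Function.Injective β) (i : Fin g) :
    MvPowerSeries.coeff (β i) (monomialSum K β) = 1 := by
  classical
  simp [monomialSum, MvPowerSeries.coeff_monomial, hβ.eq_iff]

theorem exists_of_coeff_monomialSum_ne_zero {β : Fin g → Fin d →₀ ℕ} {n : Fin d →₀ ℕ}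
    (hn : MvPowerSeries.coeff n (monomialSum K β) ≠ 0) : ∃ i, n = β i := by
  classical
  rw [monomialSum, map_sum] at hn
  obtain ⟨i, -, hi⟩ := Finset.exists_ne_zero_of_sum_ne_zero hn
  rw [MvPowerSeries.coeff_monomial] at hi
  exact ⟨i, by_contra fun h0 => hi (if_neg h0)⟩

section Contact

variable {h : Fin g → Fin d → ℚ} {β : Fin g → Fin d →₀ ℕ}

theorem hasContact_twist_monomialSum (hβ : StrictMono β) (hβh : ∀ i j, h i j = (β i j : ℚ) / k)
    {ε δ : Deck K d k} {i : Fin g}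
    (hlt : ∀ j < i, weight ε.units (intExp (β j)) = weight δ.units (intExp (β j)))
    (hi : weight ε.units (intExp (β i)) ≠ weight δ.units (intExp (β i))) :
    HasContact k (twist ε (monomialSum K β)) (twist δ (monomialSum K β)) (h i) := by
  refine hasContact_iff.2 ⟨β i, hβh i, ?_, fun n hn => ?_⟩
  · rw [coeff_twist_sub, coeff_monomialSum hβ.injective, mul_one]
    exact fun h0 => hi (Units.ext (sub_eq_zero.1 h0))
  · rw [coeff_twist_sub] at hn
    obtain ⟨j, rfl⟩ := exists_of_coeff_monomialSum_ne_zero (right_ne_zero_of_mul hn)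
    refine hβ.monotone (le_of_not_gt fun hj => left_ne_zero_of_mul hn ?_)
    rw [hlt j hj, sub_self]

theorem exists_hasContact_twist_monomialSum (hβ : StrictMono β)
    (hβh : ∀ i j, h i j = (β i j : ℚ) / k) {ε δ : Deck K d k}
    (hne : twist ε (monomialSum K β) ≠ twist δ (monomialSum K β)) :
    ∃ i, HasContact k (twist ε (monomialSum K β)) (twist δ (monomialSum K β)) (h i) := by
  have hex : {i | weight ε.units (intExp (β i)) ≠ weight δ.units (intExp (β i))}.Nonempty := by
    by_contra hemp
    refine hne (sub_eq_zero.1 ?_)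
    ext n
    rw [coeff_twist_sub, map_zero]
    by_contra h0
    obtain ⟨i, rfl⟩ := exists_of_coeff_monomialSum_ne_zero (right_ne_zero_of_mul h0)
    exact hemp ⟨i, fun h1 => left_ne_zero_of_mul h0 (by rw [h1, sub_self])⟩
  -- The contact is read off at the first exponent on which `ε` and `δ` differ.
  obtain ⟨i, hi, hmin⟩ := wellFounded_lt.has_min _ hex
  exact ⟨i, hasContact_twist_monomialSum hβ hβh
    (fun j hj => not_not.1 fun hj' => hmin j hj' hj) hi⟩

variable (K) in
-- After scaling by `k`, the lattice before `h i` becomes a subgroup `N ⊇ k ℤ^d`. The finite group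
-- `ℤ^d / N` has enough characters into `Kˣ` to separate the class of `β i` from the identity; the
-- values on the basis vectors are `k`-th roots of unity and give `ε`.
theorem exists_weight_ne_one [IsAlgClosed K] [CharZero K] (hk : k ≠ 0)
    (hβh : ∀ i j, h i j = (β i j : ℚ) / k) {i : Fin g} (hi : h i ∉ latticeBefore h i) :
    ∃ ε : Deck K d k, (∀ j < i, weight ε.units (intExp (β j)) = 1) ∧
      weight ε.units (intExp (β i)) ≠ 1 := by
  have hk' : (k : ℚ) ≠ 0 := by exact_mod_cast hk
  let φ : (Fin d → ℤ) →+ (Fin d → ℚ) :=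
    { toFun := fun w j => (w j : ℚ) / k
      map_zero' := by ext; simp
      map_add' := fun v w => by ext; simp [add_div] }
  have hφ : ∀ j, φ (intExp (β j)) = h j := fun j => by
    ext s
    simp [φ, hβh, intExp]
  let N : AddSubgroup (Fin d → ℤ) := (latticeBefore h i).comap φ
  have hkN : ∀ w : Fin d → ℤ, (k : ℤ) • w ∈ N := fun w =>
    (le_sup_left : integerLattice d ≤ latticeBefore h i) fun j => ⟨w j, by
      simp [φ, mul_div_cancel_left₀ _ hk']⟩
  have hfin : Finite ((Fin d → ℤ) ⧸ N) := by
    refine Module.finite_of_fg_torsion _ fun x => ?_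
    obtain ⟨w, rfl⟩ := QuotientAddGroup.mk_surjective x
    refine ⟨⟨(k : ℤ), mem_nonZeroDivisors_of_ne_zero (by exact_mod_cast hk)⟩, ?_⟩
    exact (QuotientAddGroup.eq_zero_iff ((k : ℤ) • w)).2 (hkN w)
  let G := Multiplicative ((Fin d → ℤ) ⧸ N)
  have : Finite G := hfin
  have : NeZero (Monoid.exponent G : K) :=
    ⟨by exact_mod_cast Monoid.exponent_ne_zero_of_finite⟩
  have ha : (Multiplicative.ofAdd (QuotientAddGroup.mk' N (intExp (β i))) : G) ≠ 1 := by
    intro h1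
    have h2 : intExp (β i) ∈ N := (QuotientAddGroup.eq_zero_iff _).1 (ofAdd_eq_one.1 h1)
    exact hi (by simpa [N, hφ] using h2)
  obtain ⟨ψ, hψ⟩ := CommGroup.exists_apply_ne_one_of_hasEnoughRootsOfUnity G K ha
  let χ : Multiplicative (Fin d → ℤ) →* Kˣ :=
    ψ.comp (AddMonoidHom.toMultiplicative (QuotientAddGroup.mk' N))
  have hχN : ∀ w ∈ N, χ (Multiplicative.ofAdd w) = 1 := fun w hw => by
    have : QuotientAddGroup.mk' N w = 0 := (QuotientAddGroup.eq_zero_iff _).2 hw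
    change ψ (Multiplicative.ofAdd (QuotientAddGroup.mk' N w)) = 1
    rw [this, ofAdd_zero, map_one]
  let ε : Deck K d k := fun s => ⟨χ (Multiplicative.ofAdd (Pi.single s 1)), by
    rw [mem_rootsOfUnity, ← map_pow, ← ofAdd_nsmul, ← natCast_zsmul]
    exact hχN _ (hkN _)⟩
  have hε : ∀ w : Fin d → ℤ, weight ε.units w = χ (Multiplicative.ofAdd w) := fun w => by
    conv_rhs => rw [← Finset.univ_sum_single w, ofAdd_sum, map_prod]
    refine Finset.prod_congr rfl fun s _ => ?_
    have : (Pi.single s (w s) : Fin d → ℤ) = w s • Pi.single s 1 := by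
      rw [← Pi.single_smul, smul_eq_mul, mul_one]
    rw [this, ofAdd_zsmul, map_zpow]
    rfl
  refine ⟨ε, fun j hj => ?_, ?_⟩
  · rw [hε]
    refine hχN _ ?_
    change φ _ ∈ latticeBefore h i
    rw [hφ]
    exact (le_sup_right : _ ≤ latticeBefore h i) (AddSubgroup.subset_closure ⟨j, hj, rfl⟩)
  · rw [hε]
    exact hψ

end Contact

end

/-! ### Realising a given sequence. -/

noncomputable section

open Polynomial

variable {K : Type*} [Field K] {d k g : ℕ}

theorem isWeierstrass_of_overRoots_eq_orbitPoly [NeZero k] (hk : k ≠ 0)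
    {y : MvPowerSeries (Fin d) K} (hy0 : MvPowerSeries.constantCoeff y = 0)
    {f : Polynomial (MvPowerSeries (Fin d) K)} (hf : f.Monic)
    (hy : overRoots k hk f = orbitPoly k y) : IsWeierstrass f := by
  refine ⟨hf, fun i hi => ?_⟩
  -- All conjugates of `y` have zero constant term, so modulo the maximal ideal only the top power
  -- survives.
  have h1 : (overRoots k hk f).map (MvPowerSeries.constantCoeff (σ := Fin d) (R := K)) =
      X ^ (orbit k y).card := by
    rw [hy, orbitPoly, Polynomial.map_prod, Finset.prod_eq_pow_card]
    intro z hz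
    obtain ⟨ε, rfl⟩ := mem_orbit.1 hz
    simp [constantCoeff_twist, hy0]
  have h2 := congrArg (fun p => p.coeff i) h1
  rw [← natDegree_overRoots hk hf, hy, natDegree_orbitPoly] at hi
  simpa [overRoots, coeff_X_pow, hi.ne] using h2

theorem isQuasiOrdinary_of_overRoots_eq_orbitPoly [NeZero k] (hk : k ≠ 0)
    {y : MvPowerSeries (Fin d) K}
    (hd : ∀ z ∈ orbit k y, ∀ w ∈ orbit k y, z ≠ w → z - w ∈ monomialUnits K d)
    {f : Polynomial (MvPowerSeries (Fin d) K)} (hf : f.Monic)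
    (hy : overRoots k hk f = orbitPoly k y) : IsQuasiOrdinary f := by
  refine ⟨hf, mem_monomialUnits_of_expand hk ?_⟩
  have hpos := natDegree_orbitPoly_pos (k := k) y
  have h1 : f.natDegree = (orbitPoly k y).natDegree := by
    rw [← hy, natDegree_overRoots hk hf]
  have h2 := discr_map_of_monic
    (MvPowerSeries.expand (σ := Fin d) (R := K) k hk).toRingHom hf (h1 ▸ hpos)
  change (overRoots k hk f).discr = MvPowerSeries.expand k hk f.discr at h2
  rw [← h2, hy]
  refine discr_mem_monomialUnits (orbitPoly_monic y) hpos (orbitPoly_splits y) ?_ ?_ <;>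
    rw [roots_orbitPoly]
  · exact (orbit k y).nodup
  · exact fun z hz w hw hne => hd z hz w hw hne.symm

theorem HasContact.sub_mem_monomialUnits {y z : MvPowerSeries (Fin d) K} {l : Fin d → ℚ}
    (h : HasContact k y z l) : y - z ∈ monomialUnits K d := by
  obtain ⟨β, u, hu, he, -⟩ := h
  exact ⟨β, u, hu, he⟩

variable (K) in
theorem exists_isCharacteristicSequence [IsAlgClosed K] [CharZero K] (h : Fin g → Fin d → ℚ)
    (h_nonneg : ∀ i j, 0 ≤ h i j) (hmono : StrictMono h) (hl : ∀ i, h i ∉ latticeBefore h i) :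
    ∃ f : Polynomial (MvPowerSeries (Fin d) K),
      IsWeierstrass f ∧ IsQuasiOrdinary f ∧ Irreducible f ∧ IsCharacteristicSequence f h := by
  obtain ⟨k, hk, β, hβh⟩ := exists_common_denominator h h_nonneg
  have : NeZero k := ⟨hk⟩
  have hβ : StrictMono β := fun i j hij => by
    rw [lt_iff_le_not_ge, ← le_iff_of_eq_div hk (hβh i) (hβh j),
      ← le_iff_of_eq_div hk (hβh j) (hβh i), ← lt_iff_le_not_ge]
    exact hmono hij
  have hy0 : MvPowerSeries.constantCoeff (monomialSum K β) = 0 := by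
    by_contra h0
    rw [← MvPowerSeries.coeff_zero_eq_constantCoeff_apply] at h0
    obtain ⟨i, hi⟩ := exists_of_coeff_monomialSum_ne_zero h0
    have : h i = 0 := by
      ext j
      simp [hβh, ← hi]
    exact hl i (this ▸ zero_mem _)
  obtain ⟨f, hf, hfy⟩ := exists_overRoots_eq_orbitPoly (monomialSum K β) hk
  have hcontact : ∀ z ∈ orbit k (monomialSum K β), ∀ w ∈ orbit k (monomialSum K β), z ≠ w →
      ∃ i, HasContact k z w (h i) := by
    intro z hz w hw hne
    obtain ⟨ε, rfl⟩ := mem_orbit.1 hz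
    obtain ⟨δ, rfl⟩ := mem_orbit.1 hw
    exact exists_hasContact_twist_monomialSum hβ hβh hne
  refine ⟨f, isWeierstrass_of_overRoots_eq_orbitPoly hk hy0 hf hfy,
    isQuasiOrdinary_of_overRoots_eq_orbitPoly hk (fun z hz w hw hne => ?_) hf hfy,
    irreducible_of_overRoots_eq_orbitPoly hk hf hfy, hmono, k, hk, ?_⟩
  · obtain ⟨i, hi⟩ := hcontact z hz w hw hne
    exact hi.sub_mem_monomialUnits
  rw [hfy]
  refine ⟨orbitPoly_splits _, fun y hy => ⟨fun z hz hne => ?_, fun i => ?_⟩⟩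
  · exact hcontact z (isRoot_orbitPoly.1 hz) y (isRoot_orbitPoly.1 hy) hne
  · obtain ⟨δ, rfl⟩ := mem_orbit.1 (isRoot_orbitPoly.1 hy)
    obtain ⟨ε, hε, hεi⟩ := exists_weight_ne_one K hk hβh (hl i)
    -- Composing with `ε` moves an arbitrary root `twist δ y` just as it moves `y`: the ratio of the
    -- two weights is that of `ε`.
    have hc : HasContact k (twist (ε * δ) (monomialSum K β)) (twist δ (monomialSum K β)) (h i) :=
      hasContact_twist_monomialSum hβ hβh
        (fun j hj => by rw [Deck.units_mul, weight_mul, hε j hj, one_mul])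
        (by rwa [Deck.units_mul, weight_mul, Ne, mul_eq_right])
    refine ⟨_, isRoot_orbitPoly.2 (mem_orbit.2 ⟨ε * δ, rfl⟩), fun he => ?_, hc⟩
    obtain ⟨_, _, hne, _⟩ := hasContact_iff.1 hc
    exact hne (by rw [he, sub_self, map_zero])

end

end QuasiOrdinary

theorem mainTheorem9 (K : Type*) [Field K] [IsAlgClosed K] [CharZero K] (d g : ℕ)
    (h : Fin g → Fin d → ℚ) (h_nonneg : ∀ i j, 0 ≤ h i j) :
    (∃ f : Polynomial (MvPowerSeries (Fin d) K),
        QuasiOrdinary.IsWeierstrass f ∧ QuasiOrdinary.IsQuasiOrdinary f ∧ Irreducible f ∧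
          QuasiOrdinary.IsCharacteristicSequence f h) ↔
      StrictMono h ∧ ∀ i, h i ∉ QuasiOrdinary.latticeBefore h i :=
  ⟨fun ⟨_, hw, _, hirr, hc⟩ => ⟨hc.1, QuasiOrdinary.notMem_latticeBefore hw.1 hirr hc⟩,
    fun ⟨hmono, hl⟩ => QuasiOrdinary.exists_isCharacteristicSequence K h h_nonneg hmono hl⟩
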